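/- For an element $s$ of a finite semigroup, let $s^\omega$ denote the unique idempotent among the powers $s^n$ ($n\ge 1$), and put $s^{\omega+1}=s^\omega s$. Let $\mathsf V_1=[\![(exf)^{\omega+1}=exf]\!]$ be the pseudovariety of all finite semigroups $S$ such that $(exf)^{\omega+1}=exf$ for all $t,x,z\in S$, where $e=t^\omega$ and $f=z^\omega$ (that is, for all idempotents $e,f\in S$ and all $x\in S$). For a subsemigroup $U$ of a semigroup $S$, the dominion $\mathrm{Dom}(U,S)$ is the set of all $d\in S$ such that $d\alpha=d\beta$ for every semigroup $T$ and all homomorphisms $\alpha,\beta:S\to T$ that agree on $U$. A semigroup $U$ is saturated if $\mathrm{Dom}(U,S)\neq S$ for every semigroup $S$, finite or infinite, that properly contains $U$ as a subsemigroup. Theorem. (1) $\mathsf V_1$ is saturated: every member of $\mathsf V_1$ is a saturated semigroup. (2) $\mathsf V_1$ is epimorphically closed: if $S\in\mathsf V_1$ and $\alpha:S\to T$ is an epimorphism in the category of all semigroups (with $T$ finite or infinite), then $T\in\mathsf V_1$. -/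

import Mathlib

universe u

namespace SemigroupEpi

/-- The positive powers of an element of a semigroup: `spow s n` is `s ^ (n + 1)`. -/
def spow {S : Type u} [Semigroup S] (s : S) : ℕ → S
  | 0 => s
  | n + 1 => spow s n * s

theorem spow_mul_spow {S : Type u} [Semigroup S] (s : S) (m n : ℕ) :
    spow s m * spow s n = spow s (m + n + 1) := by
  induction n with
  | zero => rfl
  | succ n ih =>
    change spow s m * (spow s n * s) = spow s (m + n + 1) * s
    rw [← mul_assoc, ih]

theorem spow_of_idem {S : Type u} [Semigroup S] {s : S} {m : ℕ}
    (h : IsIdempotentElem (spow s m)) (k : ℕ) :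
    spow s ((m + 1) * (k + 1) - 1) = spow s m := by
  induction k with
  | zero => simp
  | succ k ih =>
    have h1 : (m + 1) * (k + 1 + 1) - 1 = ((m + 1) * (k + 1) - 1) + m + 1 := by
      have : 0 < (m + 1) * (k + 1) := by positivity
      rw [Nat.mul_succ]
      omega
    rw [h1, ← spow_mul_spow, ih, h.eq]

/-- Every element of a finite semigroup has exactly one idempotent power. -/
theorem existsUnique_idem_power {S : Type u} [Semigroup S] [Finite S] (s : S) :
    ∃! e : S, IsIdempotentElem e ∧ ∃ n : ℕ, e = spow s n := by
  obtain ⟨i, d, hd, hid⟩ : ∃ i d : ℕ, 0 < d ∧ spow s (i + d) = spow s i := by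
    obtain ⟨a, b, hab, h⟩ := Finite.exists_ne_map_eq_of_infinite (spow s)
    rcases lt_or_gt_of_ne hab with hlt | hlt
    · exact ⟨a, b - a, by omega, by rw [Nat.add_sub_cancel' hlt.le, h]⟩
    · exact ⟨b, a - b, by omega, by rw [Nat.add_sub_cancel' hlt.le, h]⟩
  have h1 : ∀ r : ℕ, spow s (i + r + d) = spow s (i + r) := by
    intro r
    induction r with
    | zero => exact hid
    | succ r ih =>
      have h2 : i + (r + 1) + d = (i + r + d) + 1 := by omega
      rw [h2]
      change spow s (i + r + d) * s = spow s (i + r) * s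
      rw [ih]
  have h2 : ∀ k r : ℕ, spow s (i + r + k * d) = spow s (i + r) := by
    intro k
    induction k with
    | zero => intro r; simp
    | succ k ih =>
      intro r
      have h3 : i + r + (k + 1) * d = i + (r + k * d) + d := by ring
      rw [h3, h1, ← add_assoc, ih]
  have hle : i + 1 ≤ (i + 1) * d := Nat.le_mul_of_pos_right _ hd
  obtain ⟨r, hr⟩ : ∃ r, (i + 1) * d = i + r + 1 := ⟨(i + 1) * d - (i + 1), by omega⟩
  refine ⟨spow s (i + r), ⟨?_, _, rfl⟩, ?_⟩
  · change spow s (i + r) * spow s (i + r) = spow s (i + r)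
    rw [spow_mul_spow]
    have h4 : i + r + (i + r) + 1 = i + r + (i + 1) * d := by omega
    rw [h4, h2]
  · have hidem : IsIdempotentElem (spow s (i + r)) := by
      change spow s (i + r) * spow s (i + r) = spow s (i + r)
      rw [spow_mul_spow]
      have h4 : i + r + (i + r) + 1 = i + r + (i + 1) * d := by omega
      rw [h4, h2]
    rintro e ⟨he, n, rfl⟩
    rw [← spow_of_idem he (i + r), ← spow_of_idem hidem n, mul_comm]

/-- The `ω`-power `s ^ ω` of an element of a finite semigroup: its only idempotent power. -/
noncomputable def omegaPow {S : Type u} [Semigroup S] [Finite S] (s : S) : S :=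
  (existsUnique_idem_power s).choose

/-- The class `⟦(exf)^{ω+1} = exf⟧` of finite semigroups, where `e = t ^ ω` and `f = z ^ ω`, and
where `w ^ (ω + 1)` is `w ^ ω * w`. -/
def V1 (S : Semigrp.{u}) : Prop :=
  ∃ _ : Finite S, ∀ t x z : S,
    omegaPow (omegaPow t * x * omegaPow z) * (omegaPow t * x * omegaPow z) =
      omegaPow t * x * omegaPow z

/-- The dominion of a subsemigroup `U` in a semigroup `S`. -/
def dominion {S : Type u} [Semigroup S] (U : Subsemigroup S) : Set S :=
  {d | ∀ (T : Type u) [Semigroup T] (α β : S →ₙ* T), (∀ x ∈ U, α x = β x) → α d = β d}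

/-- `U` is saturated if it is not properly epimorphically embedded in any semigroup `S`, finite or
infinite. Embeddings of `U` in `S` are injective homomorphisms. -/
def IsSaturated (U : Semigrp.{u}) : Prop :=
  ∀ (S : Type u) [Semigroup S] (φ : U →ₙ* S), Function.Injective φ →
    φ.srange ≠ ⊤ → dominion φ.srange ≠ Set.univ

/-- A class of semigroups is saturated if each of its members is. -/
def IsSaturatedClass (C : Semigrp.{u} → Prop) : Prop :=
  ∀ U : Semigrp.{u}, C U → IsSaturated U

/-- A class of semigroups is epimorphically closed if it contains the codomain of every epimorphism
(of the category of all semigroups) whose domain it contains. -/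
def IsEpimorphicallyClosed (C : Semigrp.{u} → Prop) : Prop :=
  ∀ (S T : Semigrp.{u}) (α : S ⟶ T), CategoryTheory.Epi α → C S → C T

end SemigroupEpi

/-! Both parts reduce to `eq_top_of_dominion_eq_univ`, applied to the image `U` of a member of `V1`:
for (1) under an embedding, for (2) under the epimorphism, which is therefore onto, and `V1` passes
to quotients. Suppose `U` has full dominion but is proper. A weak form of Isbell's zigzag theorem,
proved with derivations into a bimodule of functions, writes each `d ∉ U` as `x * a * y` with `x ∉
U` and `a`, `x * a` in `U`; dually on the right. By finiteness, elements outside `U` factor through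
idempotents of `U`. Complete regularity of the elements `e * x * f` then turns rank bounds for right
identities of outside elements into strictly smaller bounds for left identities
(`exists_left_identity_rank_lt`). Alternating this with its dual is an impossible infinite descent.
-/

open MulOpposite

namespace SemigroupEpi

/-! ### Dominions and zigzag crossings. -/

section Dominion

variable {S : Type u} [Semigroup S]

/-- The split extension of a semigroup `S` by the bimodule of functions `S¹ → S¹ → ℤ`. -/
@[ext]
structure FunExt (S : Type u) where
  base : S
  fib : WithOne S → WithOne S → ℤ

instance : Semigroup (FunExt S) where
  mul a b := ⟨a.base * b.base, fun p q => b.fib (p * a.base) q + a.fib p (b.base * q)⟩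
  mul_assoc a b c := by
    refine FunExt.ext_iff.2 ⟨mul_assoc _ _ _, ?_⟩
    funext p q
    change c.fib (p * ((a.base * b.base : S) : WithOne S)) q +
        (b.fib (p * a.base) (c.base * q) + a.fib p (b.base * (c.base * q))) =
      (c.fib (p * a.base * b.base) q + b.fib (p * a.base) (c.base * q)) +
        a.fib p (((b.base * c.base : S) : WithOne S) * q)
    simp only [WithOne.coe_mul, mul_assoc, add_assoc]

/-- The trivial section of `FunExt S`. -/
def FunExt.zeroSection : S →ₙ* FunExt S where
  toFun s := ⟨s, fun _ _ => 0⟩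
  map_mul' _ _ := FunExt.ext_iff.2 ⟨rfl, by
    funext p q
    change (0 : ℤ) = 0 + 0
    simp⟩

/-- The section of `FunExt S` given by the inner derivation of a function `S¹ → S¹ → ℤ`. -/
def FunExt.innerSection (φ : WithOne S → WithOne S → ℤ) : S →ₙ* FunExt S where
  toFun s := ⟨s, fun p q => φ (p * s) q - φ p (s * q)⟩
  map_mul' s t := FunExt.ext_iff.2 ⟨rfl, by
    funext p q
    change φ (p * ((s * t : S) : WithOne S)) q - φ p (((s * t : S) : WithOne S) * q) =
      (φ (p * s * t) q - φ (p * s) (t * q)) + (φ (p * s) (t * q) - φ p (s * (t * q)))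
    simp only [WithOne.coe_mul, mul_assoc]
    ring⟩

/-- A function on `S¹ × S¹` that is balanced over `U` identifies `(d, 1)` and `(1, d)` for every
`d` in the dominion of `U`. -/
theorem balanced_eq_of_mem_dominion {U : Subsemigroup S} {d : S} (hd : d ∈ dominion U)
    (φ : WithOne S → WithOne S → ℤ)
    (hφ : ∀ u ∈ U, ∀ p q : WithOne S, φ (p * u) q = φ p (u * q)) :
    φ d 1 = φ 1 d := by
  have h := hd (FunExt S) (FunExt.innerSection φ) FunExt.zeroSection (by
    intro u hu
    refine FunExt.ext_iff.2 ⟨rfl, ?_⟩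
    funext p q
    exact sub_eq_zero.2 (hφ u hu p q))
  have h1 := congrFun (congrFun (FunExt.ext_iff.1 h).2 1) 1
  change φ (1 * d) 1 - φ 1 (d * 1) = 0 at h1
  rw [one_mul, mul_one] at h1
  exact sub_eq_zero.1 h1

/-- Test against the indicator of the pairs `(p, q)` with `p * q = d` and `p ∈ U¹`. It separates
`(1, d)` from `(d, 1)`, so it is not balanced, and balance can only fail at a crossing. -/
theorem exists_left_crossing {U : Subsemigroup S} {d : S} (hd : d ∈ dominion U) (hdU : d ∉ U) :
    ∃ x a y, x ∉ U ∧ a ∈ U ∧ x * a ∈ U ∧ x * a * y = d := by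
  classical
  by_contra hno
  push Not at hno
  let A : WithOne S → Prop := fun p => ∀ s : S, p = s → s ∈ U
  have key := balanced_eq_of_mem_dominion hd
    (fun p q => if A p ∧ p * q = d then 1 else 0) (by
      intro u hu p q
      have : (A (p * u) ∧ p * u * q = d) ↔ (A p ∧ p * (u * q) = d) := by
        rw [mul_assoc]
        refine and_congr_left fun hpq => ⟨?_, ?_⟩
        -- Only this direction can fail: `x ∉ U` with `x * u ∈ U`. The case `q = 1` would put `d` in
        -- `U`.
        · rintro h x rfl
          by_contra hx
          have hxu : x * u ∈ U := h _ (WithOne.coe_mul _ _).symm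
          induction q using WithOne.recOneCoe with
          | one =>
            rw [mul_one, ← WithOne.coe_mul, WithOne.coe_inj] at hpq
            exact hdU (hpq ▸ hxu)
          | coe y =>
            rw [← WithOne.coe_mul, ← WithOne.coe_mul, WithOne.coe_inj, ← mul_assoc] at hpq
            exact hno x u y hx hu hxu hpq
        · intro h s hs
          induction p using WithOne.recOneCoe with
          | one =>
            rw [one_mul, WithOne.coe_inj] at hs
            exact hs ▸ hu
          | coe x =>
            rw [← WithOne.coe_mul, WithOne.coe_inj] at hs
            exact hs ▸ U.mul_mem (h x rfl) hu
      simp only [this])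
  have h1 : A 1 := fun s hs => absurd hs.symm WithOne.coe_ne_one
  have h2 : ¬ A d := fun h => hdU (h d rfl)
  simp [h1, h2] at key

theorem exists_right_crossing {U : Subsemigroup S} {d : S} (hd : d ∈ dominion U) (hdU : d ∉ U) :
    ∃ x a y, y ∉ U ∧ a ∈ U ∧ a * y ∈ U ∧ x * a * y = d := by
  classical
  by_contra hno
  push Not at hno
  let A : WithOne S → Prop := fun p => ∀ s : S, p = s → s ∈ U
  have key := balanced_eq_of_mem_dominion hd
    (fun p q => if A q ∧ p * q = d then 1 else 0) (by
      intro u hu p q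
      have : (A q ∧ p * u * q = d) ↔ (A (u * q) ∧ p * (u * q) = d) := by
        rw [mul_assoc]
        refine and_congr_left fun hpq => ⟨?_, ?_⟩
        · intro h s hs
          induction q using WithOne.recOneCoe with
          | one =>
            rw [mul_one, WithOne.coe_inj] at hs
            exact hs ▸ hu
          | coe y =>
            rw [← WithOne.coe_mul, WithOne.coe_inj] at hs
            exact hs ▸ U.mul_mem hu (h y rfl)
        · rintro h y rfl
          by_contra hy
          have huy : u * y ∈ U := h _ (WithOne.coe_mul _ _).symm
          induction p using WithOne.recOneCoe with
          | one =>
            rw [one_mul, ← WithOne.coe_mul, WithOne.coe_inj] at hpq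
            exact hdU (hpq ▸ huy)
          | coe x =>
            rw [← WithOne.coe_mul, ← WithOne.coe_mul, WithOne.coe_inj, ← mul_assoc] at hpq
            exact hno x u y hy hu huy hpq
      simp only [this])
  have h1 : A 1 := fun s hs => absurd hs.symm WithOne.coe_ne_one
  have h2 : ¬ A d := fun h => hdU (h d rfl)
  simp [h1, h2] at key

end Dominion

/-! ### Idempotent powers and stability in finite semigroups. -/

section Powers

variable {S : Type u} [Semigroup S]

theorem map_spow {T : Type u} [Semigroup T] (φ : S →ₙ* T) (s : S) (n : ℕ) :
    φ (spow s n) = spow (φ s) n := by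
  induction n with
  | zero => rfl
  | succ n ih =>
    change φ (spow s n * s) = spow (φ s) n * φ s
    rw [map_mul, ih]

theorem spow_mem {U : Subsemigroup S} {s : S} (hs : s ∈ U) (n : ℕ) : spow s n ∈ U := by
  induction n with
  | zero => exact hs
  | succ n ih => exact U.mul_mem ih hs

theorem spow_eq_self {s : S} (h : IsIdempotentElem s) (n : ℕ) : spow s n = s := by
  induction n with
  | zero => rfl
  | succ n ih =>
    change spow s n * s = s
    rw [ih, h.eq]

theorem exists_isIdempotentElem_spow {U : Subsemigroup S} (hU : (U : Set S).Finite) {s : S}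
    (hs : s ∈ U) : ∃ n, IsIdempotentElem (spow s n) := by
  have : Finite U := hU
  obtain ⟨e, ⟨he, n, rfl⟩, -⟩ := existsUnique_idem_power (⟨s, hs⟩ : U)
  refine ⟨n, ?_⟩
  have h := map_spow (MulMemClass.subtype U) ⟨s, hs⟩ n
  change _ = spow s n at h
  rw [← h]
  exact he.map (MulMemClass.subtype U)

theorem omegaPow_idem [Finite S] (s : S) : IsIdempotentElem (omegaPow s) :=
  (existsUnique_idem_power s).choose_spec.1.1

theorem exists_omegaPow_eq_spow [Finite S] (s : S) : ∃ n, omegaPow s = spow s n :=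
  (existsUnique_idem_power s).choose_spec.1.2

theorem eq_omegaPow [Finite S] {s e : S} (he : IsIdempotentElem e) (h : ∃ n, e = spow s n) :
    e = omegaPow s :=
  (existsUnique_idem_power s).choose_spec.2 e ⟨he, h⟩

theorem map_omegaPow {T : Type u} [Semigroup T] [Finite S] [Finite T] (φ : S →ₙ* T) (s : S) :
    φ (omegaPow s) = omegaPow (φ s) := by
  obtain ⟨n, hn⟩ := exists_omegaPow_eq_spow s
  exact eq_omegaPow ((omegaPow_idem s).map φ) ⟨n, by rw [hn, map_spow]⟩

/-- An element with `w ^ (ω + 1) = w` is completely regular. -/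
theorem exists_inverse_of_omegaPow_mul [Finite S] {w : S} (h : omegaPow w * w = w) :
    ∃ v, w * v * w = w ∧ w * v = v * w := by
  obtain ⟨n, hn⟩ := exists_omegaPow_eq_spow w
  have hg := (omegaPow_idem w).eq
  rw [hn, spow_mul_spow] at hg
  have h1 : w * spow w (n + n) = spow w (n + n + 1) := by
    have := spow_mul_spow w 0 (n + n)
    rwa [Nat.zero_add] at this
  -- With `w ^ ω = w ^ (n + 1)`, the inverse is `w ^ (2n + 1)`: its product with `w` is `w ^ ω`
  -- squared.
  refine ⟨spow w (n + n), ?_, h1⟩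
  rw [h1, hg, ← hn, h]

/-- In a finite semigroup, `𝓡`-comparable idempotents that are `𝓙`-equivalent are
`𝓡`-equivalent. -/
theorem mul_eq_of_factor {U : Subsemigroup S} (hU : (U : Set S).Finite) {f h p q : S}
    (hh : h ∈ U) (hq : q ∈ U) (hidem : IsIdempotentElem h) (hfh : f * h = h)
    (hf : f = p * h * q) : h * f = f := by
  obtain ⟨n, hn⟩ := exists_isIdempotentElem_spow hU (U.mul_mem hh hq)
  have h1 : ∀ n, ∃ r, f = r * spow (h * q) n := by
    intro n
    induction n with
    | zero => exact ⟨p, by rw [hf, mul_assoc]; rfl⟩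
    | succ n ih =>
      obtain ⟨r, hr⟩ := ih
      refine ⟨p * r, ?_⟩
      change f = p * r * (spow (h * q) n * (h * q))
      rw [mul_assoc, ← mul_assoc r, ← hr, ← mul_assoc f, hfh, ← mul_assoc]
      exact hf
  have h2 : ∀ n, f * spow (h * q) n = spow (h * q) n ∧ h * spow (h * q) n = spow (h * q) n := by
    intro n
    induction n with
    | zero =>
      change f * (h * q) = h * q ∧ h * (h * q) = h * q
      rw [← mul_assoc, hfh, ← mul_assoc, hidem.eq]
      exact ⟨rfl, rfl⟩
    | succ n ih =>
      change f * (spow (h * q) n * (h * q)) = spow (h * q) n * (h * q) ∧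
        h * (spow (h * q) n * (h * q)) = spow (h * q) n * (h * q)
      exact ⟨by rw [← mul_assoc, ih.1], by rw [← mul_assoc, ih.2]⟩
  obtain ⟨r, hr⟩ := h1 n
  -- For the idempotent `s = (h * q) ^ (n + 1)`, `f = r * s` gives `f * s = f`, while `f * h = h`
  -- gives `f * s = s`.
  have h3 : f = spow (h * q) n := by
    rw [← (h2 n).1]
    nth_rw 2 [hr]
    rw [mul_assoc, hn.eq, ← hr]
  rw [h3, (h2 n).2]

end Powers

/-! ### Idempotent factors and the rank descent. -/

section Descent

variable {S : Type u} [Semigroup S]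

/-- If every element outside `U` has a left divisor in the finite subsemigroup `U`, then it has
one that ends in an idempotent. -/
theorem exists_idempotent_left_factor {U : Subsemigroup S} (hU : (U : Set S).Finite)
    (hdiv : ∀ y ∉ U, ∃ a ∈ U, ∃ y', y = a * y') {y : S} (hy : y ∉ U) :
    ∃ u ∈ U, ∃ e ∈ U, IsIdempotentElem e ∧ ∃ y', y = u * e * y' := by
  -- `A p` is the right ideal `p * U¹`. A left divisor `p` of `y` with `A p` of least size satisfies
  -- `p = p * z` for some `z ∈ U`, hence `p = p * e` for an idempotent power `e` of `z`.
  let A : S → Set S := fun p => insert p {z | ∃ q ∈ U, z = p * q}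
  have hA : ∀ p ∈ U, A p ⊆ U := by
    rintro p hp z (rfl | ⟨q, hq, rfl⟩)
    · exact hp
    · exact U.mul_mem hp hq
  have hex : ∃ n p, p ∈ U ∧ (∃ y', y = p * y') ∧ (A p).ncard = n := by
    obtain ⟨a, ha, h⟩ := hdiv y hy
    exact ⟨_, a, ha, h, rfl⟩
  classical
  obtain ⟨p, hp, ⟨y', hy'⟩, hn⟩ := Nat.find_spec hex
  have hyU : y' ∉ U := fun h => hy (hy' ▸ U.mul_mem hp h)
  obtain ⟨a, ha, y'', rfl⟩ := hdiv y' hyU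
  have hsub : A (p * a) ⊆ A p := by
    rintro z (rfl | ⟨q, hq, rfl⟩)
    · exact Or.inr ⟨a, ha, rfl⟩
    · exact Or.inr ⟨a * q, U.mul_mem ha hq, mul_assoc _ _ _⟩
  have hle : (A p).ncard ≤ (A (p * a)).ncard := by
    rw [hn]
    exact Nat.find_min' hex
      ⟨p * a, U.mul_mem hp ha, ⟨y'', by rw [hy', mul_assoc]⟩, rfl⟩
  have heq := Set.eq_of_subset_of_ncard_le hsub hle (hU.subset (hA p hp))
  have hpA : p ∈ A (p * a) := heq ▸ Set.mem_insert _ _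
  obtain ⟨z, hz, hpz⟩ : ∃ z ∈ U, p = p * z := by
    rcases hpA with h | ⟨q, hq, h⟩
    · exact ⟨a, ha, h⟩
    · exact ⟨a * q, U.mul_mem ha hq, by rw [← mul_assoc]; exact h⟩
  obtain ⟨n, hidem⟩ := exists_isIdempotentElem_spow hU hz
  have hpow : ∀ n, p * spow z n = p := by
    intro n
    induction n with
    | zero => exact hpz.symm
    | succ n ih =>
      change p * (spow z n * z) = p
      rw [← mul_assoc, ih, ← hpz]
  exact ⟨p, hp, spow z n, spow_mem hz n, hidem, a * y'', by rw [hpow, hy']⟩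

/-- The elements `e * x * f` of `U`, where `e` and `f` are idempotent, are completely regular. -/
def SandwichRegular (U : Subsemigroup S) : Prop :=
  ∀ e ∈ U, ∀ x ∈ U, ∀ f ∈ U, IsIdempotentElem e → IsIdempotentElem f →
    ∃ v ∈ U, e * x * f * v * (e * x * f) = e * x * f ∧ e * x * f * v = v * (e * x * f)

/-- A rank on the elements of `U` that is compatible with the `𝓙`-order of the idempotents. -/
structure IsJRank (U : Subsemigroup S) (N : S → ℕ) : Prop where
  le : ∀ p ∈ U, ∀ f ∈ U, ∀ q ∈ U, N (p * f * q) ≤ N f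
  exists_factor : ∀ p ∈ U, ∀ f ∈ U, ∀ q ∈ U, IsIdempotentElem f → N f ≤ N (p * f * q) →
    ∃ p' ∈ U, ∃ q' ∈ U, f = p' * (p * f * q) * q'

/-- The rank of `f` is the size of `U * f * U`: nested finite ideals of equal size coincide, and an
idempotent `f` lies in its own. -/
theorem exists_isJRank {U : Subsemigroup S} (hU : (U : Set S).Finite) :
    ∃ N : S → ℕ, IsJRank U N := by
  let I : S → Set S := fun f => {z | ∃ p ∈ U, ∃ q ∈ U, z = p * f * q}
  have hI : ∀ f ∈ U, (I f).Finite := fun f hf => hU.subset (by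
    rintro _ ⟨p, hp, q, hq, rfl⟩
    exact U.mul_mem (U.mul_mem hp hf) hq)
  have hsub : ∀ p ∈ U, ∀ f, ∀ q ∈ U, I (p * f * q) ⊆ I f := by
    rintro p hp f q hq _ ⟨p', hp', q', hq', rfl⟩
    exact ⟨p' * p, U.mul_mem hp' hp, q * q', U.mul_mem hq hq', by simp only [mul_assoc]⟩
  refine ⟨fun f => (I f).ncard, fun p hp f hf q hq =>
    Set.ncard_le_ncard (hsub p hp f q hq) (hI f hf), fun p hp f hf q hq hidem hle => ?_⟩
  have heq := Set.eq_of_subset_of_ncard_le (hsub p hp f q hq) hle (hI f hf)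
  have hmem : f ∈ I f := ⟨f, hf, f, hf, by rw [hidem.eq, hidem.eq]⟩
  rw [← heq] at hmem
  exact hmem

/-- A bound on the ranks of right identities of elements outside `U` gives a strictly smaller bound
on the ranks of left identities. -/
theorem exists_left_identity_rank_lt {U : Subsemigroup S} (hU : (U : Set S).Finite)
    (hV : SandwichRegular U) {N : S → ℕ} (hN : IsJRank U N)
    (hcross : ∀ d ∉ U, ∃ x a y, x ∉ U ∧ a ∈ U ∧ x * a ∈ U ∧ x * a * y = d)
    (hright : ∀ x ∉ U, ∃ v ∈ U, ∃ f ∈ U, IsIdempotentElem f ∧ ∃ x', x = x' * f * v)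
    {k : ℕ} (hk : ∀ t ∉ U, ∀ f ∈ U, IsIdempotentElem f → t * f = t →
      ∃ g ∈ U, IsIdempotentElem g ∧ t * g = t ∧ N g ≤ k)
    {d : S} (hd : d ∉ U) {e₀ : S} (he₀ : e₀ ∈ U) (he₀i : IsIdempotentElem e₀) (hed : e₀ * d = d) :
    ∃ g ∈ U, IsIdempotentElem g ∧ g * d = d ∧ N g < k := by
  have hleft : ∀ y ∉ U, ∃ u ∈ U, ∃ e ∈ U, IsIdempotentElem e ∧ ∃ y', y = u * e * y' :=
    fun y hy => exists_idempotent_left_factor hU (fun y hy => by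
      obtain ⟨x, a, y', -, -, hxa, rfl⟩ := hcross y hy
      exact ⟨_, hxa, _, rfl⟩) hy
  obtain ⟨x, a, y, hx, ha, hxa, hxay⟩ := hcross d hd
  have hy : y ∉ U := fun h => hd (hxay ▸ U.mul_mem hxa h)
  obtain ⟨v, hv, f₁, hf₁, hf₁i, x', rfl⟩ := hright x hx
  obtain ⟨u, hu, e, he, hei, y', rfl⟩ := hleft y hy
  have hX : x' * f₁ ∉ U := fun h => hx (U.mul_mem h hv)
  obtain ⟨f, hf, hfi, hXf, hNf⟩ := hk _ hX f₁ hf₁ hf₁i (by rw [mul_assoc, hf₁i.eq])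
  generalize x' * f₁ = X at *
  -- The middle factor `c` satisfies `X * c ∈ U` and `X * c * y' = d`; the idempotent `h = c * w`
  -- lies below `f`.
  obtain ⟨w, hw, hcwc, hcw⟩ := hV f hf (v * a * u) (U.mul_mem (U.mul_mem hv ha) hu) e he hfi hei
  have hc : f * (v * a * u) * e ∈ U :=
    U.mul_mem (U.mul_mem hf (U.mul_mem (U.mul_mem hv ha) hu)) he
  have hXc : X * (f * (v * a * u) * e) = X * v * a * (u * e) := by
    rw [← mul_assoc, ← mul_assoc, hXf]
    simp only [mul_assoc]
  have hXcU : X * (f * (v * a * u) * e) ∈ U := hXc ▸ U.mul_mem hxa (U.mul_mem hu he)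
  have hXcy : X * (f * (v * a * u) * e) * y' = d := by
    rw [hXc, ← hxay]
    simp only [mul_assoc]
  have hfc : f * (f * (v * a * u) * e) = f * (v * a * u) * e := by
    rw [← mul_assoc, ← mul_assoc, hfi.eq]
  generalize f * (v * a * u) * e = c at *
  have hh : IsIdempotentElem (c * w) := by
    change c * w * (c * w) = c * w
    rw [← mul_assoc, hcwc]
  have hhU : c * w ∈ U := U.mul_mem hc hw
  have hfh : f * (c * w) = c * w := by rw [← mul_assoc, hfc]
  have hch : c * (c * w) = c := by rw [hcw, ← mul_assoc, hcwc]
  have hXh : X * (c * w) ∈ U := by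
    rw [← mul_assoc]
    exact U.mul_mem hXcU hw
  generalize c * w = h at *
  -- Since `c * h = c`, the element `b = e₀ * (X * c) * h` still gives `b * y' = d`, so the
  -- idempotent `b * r` fixes `d` on the left.
  obtain ⟨r, hr, hbrb, hbr⟩ := hV e₀ he₀ (X * c) hXcU h hhU he₀i hh
  have hby : e₀ * (X * c) * h * y' = d := by
    rw [mul_assoc e₀, mul_assoc X, hch, mul_assoc, hXcy, hed]
  have hbU : e₀ * (X * c) * h ∈ U := U.mul_mem (U.mul_mem he₀ hXcU) hhU
  refine ⟨e₀ * (X * c) * h * r, U.mul_mem hbU hr, ?_, ?_, ?_⟩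
  · change e₀ * (X * c) * h * r * (e₀ * (X * c) * h * r) = e₀ * (X * c) * h * r
    rw [← mul_assoc, hbrb]
  · rw [← hby, ← mul_assoc, hbrb]
  -- Otherwise `N f ≤ k ≤ N (b * r) ≤ N h`, so `f` and `h` are `𝓙`-equivalent and `h * f = f`; then
  -- `X = X * h * f` lies in `U`.
  · by_contra hlt
    have h1 : N (e₀ * (X * c) * h * r) ≤ N h := hN.le _ (U.mul_mem he₀ hXcU) _ hhU _ hr
    have h2 : f * f * h = h := by rw [hfi.eq, hfh]
    have h3 := hN.exists_factor f hf f hf h hhU hfi (by rw [h2]; omega)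
    rw [h2] at h3
    obtain ⟨p, -, q, hq, hpq⟩ := h3
    have h4 := mul_eq_of_factor hU hhU hq hh hfh hpq
    apply hX
    rw [← hXf, ← h4, ← mul_assoc]
    exact U.mul_mem hXh hf

end Descent

/-! ### Left-right duality. -/

section Opposite

variable {S : Type u} [Semigroup S]

theorem op_finite {U : Subsemigroup S} (hU : (U : Set S).Finite) :
    (U.op : Set Sᵐᵒᵖ).Finite :=
  Set.Finite.preimage (f := unop) (s := (U : Set S)) unop_injective.injOn hU

theorem SandwichRegular.op {U : Subsemigroup S} (hV : SandwichRegular U) :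
    SandwichRegular U.op := by
  intro e he x hx f hf hei hfi
  obtain ⟨v, hv, h1, h2⟩ := hV (unop f) hf (unop x) hx (unop e) he
    (congrArg unop hfi.eq) (congrArg unop hei.eq)
  refine ⟨MulOpposite.op v, hv, unop_injective ?_, unop_injective ?_⟩
  · simpa only [unop_mul, unop_op, mul_assoc] using h1
  · simpa only [unop_mul, unop_op, mul_assoc] using h2.symm

theorem IsJRank.op {U : Subsemigroup S} {N : S → ℕ} (hN : IsJRank U N) :
    IsJRank U.op (fun s => N (unop s)) where
  le p hp f hf q hq := by
    have := hN.le (unop q) hq (unop f) hf (unop p) hp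
    simpa only [unop_mul, mul_assoc] using this
  exists_factor p hp f hf q hq hidem hle := by
    obtain ⟨p', hp', q', hq', h⟩ := hN.exists_factor (unop q) hq (unop f) hf (unop p) hp
      (congrArg unop hidem.eq) (by simpa only [unop_mul, mul_assoc] using hle)
    refine ⟨MulOpposite.op q', hq', MulOpposite.op p', hp', unop_injective ?_⟩
    simpa only [unop_mul, unop_op, mul_assoc] using h

end Opposite

/-! ### Infinite descent and the two closure properties. -/

section Saturation

variable {S : Type u} [Semigroup S]

/-- A finite subsemigroup whose elements `e * x * f`, with `e` and `f` idempotent, are completely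
regular is not properly epimorphically embedded. -/
theorem eq_top_of_dominion_eq_univ {U : Subsemigroup S} (hU : (U : Set S).Finite)
    (hV : SandwichRegular U) (hdom : dominion U = Set.univ) : U = ⊤ := by
  by_contra htop
  obtain ⟨d, hd⟩ : ∃ d, d ∉ U := by
    by_contra h
    push Not at h
    exact htop (Subsemigroup.ext fun x => ⟨fun _ => trivial, fun _ => h x⟩)
  obtain ⟨N, hN⟩ := exists_isJRank hU
  have hL : ∀ d ∉ U, ∃ x a y, x ∉ U ∧ a ∈ U ∧ x * a ∈ U ∧ x * a * y = d :=
    fun d hd => exists_left_crossing (hdom ▸ Set.mem_univ d) hd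
  have hR : ∀ d ∉ U.op, ∃ x a y, x ∉ U.op ∧ a ∈ U.op ∧ x * a ∈ U.op ∧ x * a * y = d := by
    intro d hd
    obtain ⟨x, a, y, hy, ha, hay, h⟩ :=
      exists_right_crossing (U := U) (d := unop d) (hdom ▸ Set.mem_univ _) hd
    refine ⟨op y, op a, op x, hy, ha, hay, unop_injective ?_⟩
    simpa only [unop_mul, unop_op, mul_assoc] using h
  have hleft : ∀ y ∉ U, ∃ u ∈ U, ∃ e ∈ U, IsIdempotentElem e ∧ ∃ y', y = u * e * y' :=
    fun y hy => exists_idempotent_left_factor hU (fun y hy => by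
      obtain ⟨x, a, y', -, -, hxa, rfl⟩ := hL y hy
      exact ⟨_, hxa, _, rfl⟩) hy
  have hright : ∀ x ∉ U, ∃ v ∈ U, ∃ f ∈ U, IsIdempotentElem f ∧ ∃ x', x = x' * f * v := by
    intro x hx
    obtain ⟨u, hu, e, he, hei, y', h⟩ := exists_idempotent_left_factor (op_finite hU) (fun y hy => by
      obtain ⟨x, a, y', -, -, hxa, rfl⟩ := hR y hy
      exact ⟨_, hxa, _, rfl⟩) (y := op x) hx
    refine ⟨unop u, hu, unop e, he, congrArg unop hei.eq, unop y', op_injective ?_⟩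
    simpa only [op_mul, op_unop, mul_assoc] using h
  have hbound : ∃ k, ∀ f ∈ U, N f ≤ k := by
    obtain ⟨k, hk⟩ := (hU.image N).bddAbove
    exact ⟨k, fun f hf => hk ⟨f, hf, rfl⟩⟩
  have hdesc : ∀ k, (∀ t ∉ U, ∀ f ∈ U, IsIdempotentElem f → t * f = t →
      ∃ g ∈ U, IsIdempotentElem g ∧ t * g = t ∧ N g ≤ k) → False := by
    intro k
    induction k using Nat.strong_induction_on with
    | _ k ih =>
      intro hk
      have h1 : ∀ t ∉ U, ∀ e ∈ U, IsIdempotentElem e → e * t = t →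
          ∃ g ∈ U, IsIdempotentElem g ∧ g * t = t ∧ N g < k :=
        fun t ht e he hei het => exists_left_identity_rank_lt hU hV hN hL hright hk ht he hei het
      -- An idempotent factor of `d` supplies an outside element that has a left identity, so the
      -- bound `N g < k` is not vacuous.
      have hkpos : 0 < k := by
        obtain ⟨u, hu, e, he, hei, y', rfl⟩ := hleft d hd
        have hy : e * y' ∉ U := fun h => hd (by rw [mul_assoc]; exact U.mul_mem hu h)
        obtain ⟨g, -, -, -, hg⟩ := h1 _ hy e he hei (by rw [← mul_assoc, hei.eq])
        omega
      refine ih (k - 1) (by omega) fun t ht f hf hfi htf => ?_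
      obtain ⟨g, hg, hgi, hgt, hgk⟩ := exists_left_identity_rank_lt (op_finite hU) hV.op hN.op hR
        (fun x hx => by
          obtain ⟨u, hu, e, he, hei, y', h⟩ := hleft (unop x) hx
          refine ⟨op u, hu, op e, he, congrArg op hei.eq, op y', unop_injective ?_⟩
          simpa only [unop_mul, unop_op, mul_assoc] using h)
        (k := k) (fun t ht f hf hfi htf => by
          obtain ⟨g, hg, hgi, hgt, hgk⟩ := h1 (unop t) ht (unop f) hf (congrArg unop hfi.eq)
            (congrArg unop htf)
          exact ⟨op g, hg, congrArg op hgi.eq, unop_injective hgt, hgk.le⟩)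
        (d := op t) ht (e₀ := op f) hf (congrArg op hfi.eq) (congrArg op htf)
      exact ⟨unop g, hg, congrArg unop hgi.eq, congrArg unop hgt, by omega⟩
  obtain ⟨k, hk⟩ := hbound
  exact hdesc k fun t _ f hf hfi htf => ⟨f, hf, hfi, htf, hk f hf⟩

/-- Idempotents of the image lift to `ω`-powers, so the identity transfers without injectivity of
`φ`, as part (2) needs. -/
theorem V1.sandwichRegular_srange {U : Semigrp.{u}} (hU : V1 U) (φ : U →ₙ* S) :
    SandwichRegular φ.srange := by
  obtain ⟨_, hV⟩ := hU
  have hid : ∀ s : U, IsIdempotentElem (φ s) → φ (omegaPow s) = φ s := by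
    intro s hs
    obtain ⟨n, hn⟩ := exists_omegaPow_eq_spow s
    rw [hn, map_spow, spow_eq_self hs]
  rintro _ ⟨t, rfl⟩ _ ⟨x, rfl⟩ _ ⟨z, rfl⟩ ht hz
  obtain ⟨v, h1, h2⟩ := exists_inverse_of_omegaPow_mul (hV t x z)
  refine ⟨φ v, ⟨v, rfl⟩, ?_, ?_⟩
  · simpa only [map_mul, hid t ht, hid z hz] using congrArg φ h1
  · simpa only [map_mul, hid t ht, hid z hz] using congrArg φ h2

theorem V1.srange_eq_top_of_dominion_eq_univ {U : Semigrp.{u}} (hU : V1 U) (φ : U →ₙ* S)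
    (hdom : dominion φ.srange = Set.univ) : φ.srange = ⊤ := by
  have : Finite U := hU.1
  exact eq_top_of_dominion_eq_univ (by simpa using Set.finite_range φ)
    (hU.sandwichRegular_srange φ) hdom

theorem V1.of_surjective {U T : Semigrp.{u}} (hU : V1 U) (φ : U →ₙ* T)
    (hφ : Function.Surjective φ) : V1 T := by
  obtain ⟨_, hV⟩ := hU
  have : Finite T := Finite.of_surjective φ hφ
  refine ⟨this, fun t x z => ?_⟩
  obtain ⟨t, rfl⟩ := hφ t
  obtain ⟨x, rfl⟩ := hφ x
  obtain ⟨z, rfl⟩ := hφ z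
  simp only [← map_omegaPow, ← map_mul]
  rw [hV]

theorem dominion_srange_of_epi {U T : Semigrp.{u}} (α : U ⟶ T) (h : CategoryTheory.Epi α) :
    dominion (MulHom.srange α.hom) = Set.univ := by
  refine Set.eq_univ_of_forall fun d V _ β γ hβγ => ?_
  have h1 : Semigrp.ofHom β = Semigrp.ofHom γ := by
    rw [← CategoryTheory.cancel_epi α]
    ext s
    exact hβγ _ ⟨s, rfl⟩
  exact DFunLike.congr_fun (congrArg Semigrp.Hom.hom h1) d

end Saturation

end SemigroupEpi

theorem theoremt :
    SemigroupEpi.IsSaturatedClass SemigroupEpi.V1.{u} ∧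
      SemigroupEpi.IsEpimorphicallyClosed SemigroupEpi.V1.{u} := by
  refine ⟨fun U hU S _ φ _ hne hdom => hne (hU.srange_eq_top_of_dominion_eq_univ φ hdom),
    fun S T α hα hS => hS.of_surjective α.hom ?_⟩
  exact MulHom.srange_eq_top_iff_surjective.1
    (hS.srange_eq_top_of_dominion_eq_univ α.hom (SemigroupEpi.dominion_srange_of_epi α hα))
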